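/- **Proposition 3.1.** *Setting.* Let $l=l_1+\dots+l_r$ and $n$ be non-negative integers, and let $m_1<m_2<\dots<m_r$ be positive integers, where $m_r=+\infty$ is also allowed. Write the coordinates of $\mathbb C^N=\mathbb C^l\times\mathbb C^n$ as $(z,w)$, $z=x+iy$, and split $z=(z_{I_1},\dots,z_{I_r})$ into consecutive blocks of sizes $l_1,\dots,l_r$. Let $s\in\mathbb N\cup\{+\infty\}$ with $s\ge m_i$ for all $i$, and let $h=(h_{I_1},\dots,h_{I_r})$ be an $\mathbb R^l$-valued function of class $C^s$ on an open neighbourhood of $0$ in $\mathbb R^l_x\times\mathbb C^n_w$, with $h(0)=0$ and $dh(0)=0$. Let $$M=\{(x+iy,w):\ y=h(x,w)\},\qquad p_o=0,\qquad \rho_j=-y_j+h_j(x,w)\quad(1\le j\le l).$$ *Weighted vanishing order.* For a finite $k$ write $f=\mathcal O^k$ if for every $(x,w)$ one has $f(t^{m_1}x_{I_1},\dots,t^{m_r}x_{I_r},tw)=O(t^k)$ as $t\to0$; if $m_r=+\infty$, then $t^{m_r}$ is read here as $t^{N}$ for an arbitrary positive integer $N\ge k$. If $m_r=+\infty$, write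 $f=\mathcal O^{+\infty}$ if for every integer $N\ge1$ and every $(x,w)$ one has $f(t^{m_1}x_{I_1},\dots,t^{m_{r-1}}x_{I_{r-1}},t^{N}x_{I_r},tw)=O(t^N)$. Assume that $h_{I_i}=\mathcal O^{m_i}$ (that is, each of its components is $\mathcal O^{m_i}$) for $i=1,\dots,r$. *Brackets.* Let $T^{1,0}M$ and $T^{0,1}M$ be the bundles of vectors in $\mathbb C\otimes_{\mathbb R}TM$ of type $(1,0)$ and $(0,1)$. For $j\in\mathbb N\cup\{+\infty\}$ let $\mathcal L^j=\mathcal L^j_{p_o}\subset\mathbb C\otimes_{\mathbb R}T_{p_o}M$ be the complex span of the values at $p_o$ of all iterated Lie brackets of finite length $\le j$ of sections of $T^{1,0}M$ and $T^{0,1}M$ defined and of class $C^{s-1}$ near $p_o$ (a single section has length $1$; $\mathcal L^0=0$; $+\infty-1=+\infty$). *Statement.* For every $i\in\{1,\dots,r\}$, $$\mathcal L^{m_i-1}\subset \mathrm{Span}_{\mathbb C}\{\partial_w,\bar\partial_w,\partial_{x_{I_1}},\dots,\partial_{x_{I_{i-1}}}\},$$ and in particular, for $i\ge2$, $\mathcal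 L^{m_{i-1}}\subset \mathrm{Span}_{\mathbb C}\{\partial_w,\bar\partial_w,\partial_{x_{I_1}},\dots,\partial_{x_{I_{i-1}}}\}$. Consequently the map $$\varphi_2:\ \frac{T_{p_o}M}{\mathcal L^{m_i-1}\cap T_{p_o}M}\to\mathbb R^{l_i+\dots+l_r},\qquad [v]\mapsto\big(\partial\rho_j(Jv)\big)_{j\in I_i\cup\dots\cup I_r},$$ where $J$ is the complex structure of $\mathbb C^N$ and $\partial\rho_j$ is the $(1,0)$-part of $d\rho_j$ at $p_o$, is a well-defined (real-valued) $\mathbb R$-linear map. -/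

import Mathlib

open scoped TensorProduct Topology

noncomputable section

namespace CRBracket

/-- Index set of the `z`-coordinates: the block `I_i` consists of the indices `⟨i, a⟩`, `a < ℓ i`. -/
abbrev ZIdx {r : ℕ} (ℓ : Fin r → ℕ) : Type := (i : Fin r) × Fin (ℓ i)

/-- The ambient complex space `ℂ^l × ℂ^n` with coordinates `(z, w)`, where `l = ∑ i, ℓ i`. -/
abbrev Amb {r : ℕ} (ℓ : Fin r → ℕ) (n : ℕ) : Type := (ZIdx ℓ → ℂ) × (Fin n → ℂ)

/-- The space `ℝ^l × ℂ^n` of the variables `(x, w)`, `x = Re z`, of the graphing function. -/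
abbrev Base {r : ℕ} (ℓ : Fin r → ℕ) (n : ℕ) : Type := (ZIdx ℓ → ℝ) × (Fin n → ℂ)

/-! ### Weighted vanishing order -/

section Weights

variable {r : ℕ} {ℓ : Fin r → ℕ} {n : ℕ}

/-- The dilation `(x, w) ↦ (t ^ μ_1 x_{I_1}, …, t ^ μ_r x_{I_r}, t w)`. -/
def dilation (μ : Fin r → ℕ) (t : ℝ) (p : Base ℓ n) : Base ℓ n :=
  (fun a => t ^ μ a.1 * p.1 a, fun b => (t : ℂ) * p.2 b)

/-- `f = 𝒪^k` for the weights `m`.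

An infinite weight is replaced by an arbitrary positive integer `N`. If `k` is finite, then
`f (…, t ^ m_i x_{I_i}, …, t w) = O(t ^ k)`, where `N` is any number `≥ k`. If `k = +∞`, then
`f (t ^ m_1 x_{I_1}, …, t ^ N x_{I_r}, t w) = O(t ^ N)` for every `N`.
(`WithTop.untopD N c` is `c` for `c` finite and is `N` for `c = +∞`.) -/
def VanishesToWeight (m : Fin r → ℕ∞) (f : Base ℓ n → ℝ) (k : ℕ∞) : Prop :=
  ∀ N : ℕ, 0 < N → WithTop.untopD N k ≤ N → ∀ p : Base ℓ n,
    (fun t : ℝ => f (dilation (fun i => WithTop.untopD N (m i)) t p))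
      =O[𝓝 0] (fun t : ℝ => t ^ WithTop.untopD N k)

end Weights

/-! ### The manifold `M = {y = h(x, w)}` and its tangent spaces -/

section Manifold

variable {r : ℕ} {ℓ : Fin r → ℕ} {n : ℕ}

/-- The projection `(z, w) ↦ (Re z, w)`. -/
def toBase (p : Amb ℓ n) : Base ℓ n := (fun a => (p.1 a).re, p.2)

/-- The graph `M` of `h` over `Ω`: the points `(x + i y, w)` with `(x, w) ∈ Ω`, `y = h(x, w)`. -/
def graphSet (Ω : Set (Base ℓ n)) (h : Base ℓ n → ZIdx ℓ → ℝ) : Set (Amb ℓ n) :=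
  {p | toBase p ∈ Ω ∧ ∀ a, (p.1 a).im = h (toBase p) a}

/-- The defining functions `r_a = -y_a + h_a(x, w)` of `M`. -/
def defFun (h : Base ℓ n → ZIdx ℓ → ℝ) (a : ZIdx ℓ) (p : Amb ℓ n) : ℝ :=
  -(p.1 a).im + h (toBase p) a

/-- The real tangent space `T_p M = {v | dr_a(p) v = 0 for all a}` at a point `p` of `M`. -/
def tangent (h : Base ℓ n → ZIdx ℓ → ℝ) (p : Amb ℓ n) : Submodule ℝ (Amb ℓ n) :=
  ⨅ a, LinearMap.ker (fderiv ℝ (defFun h a) p).toLinearMap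

/-- The `(1,0)`-part `∂f` of the differential of a real function `f`, evaluated on a real vector
`v`: `∂f(v) = (df(v) - i df(J v)) / 2`, where `J v = i v` is the complex structure. -/
def del (f : Amb ℓ n → ℝ) (p v : Amb ℓ n) : ℂ :=
  (1 / 2 : ℂ) * ((fderiv ℝ f p v : ℂ) - Complex.I * (fderiv ℝ f p (Complex.I • v) : ℂ))

end Manifold

/-! ### Complex vector fields, Lie brackets, and the distributions `ℒ^j` -/

section Fields

variable {r : ℕ} {ℓ : Fin r → ℕ} {n : ℕ}

/-- A complex vector field `U + i V` on the ambient space, with `U = re` and `V = im` real vector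
fields; `i` stands for the scalar of `ℂ ⊗ T`, not for the complex structure `J`. -/
@[ext] structure CField {r : ℕ} (ℓ : Fin r → ℕ) (n : ℕ) where
  /-- the real part -/
  re : Amb ℓ n → Amb ℓ n
  /-- the imaginary part -/
  im : Amb ℓ n → Amb ℓ n

/-- The value of `U + i V` at `p`, in the complexified tangent space `ℂ ⊗ T_p`. -/
def CField.val (X : CField ℓ n) (p : Amb ℓ n) : ℂ ⊗[ℝ] Amb ℓ n :=
  (1 : ℂ) ⊗ₜ[ℝ] X.re p + Complex.I ⊗ₜ[ℝ] X.im p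

/-- The Lie bracket of real vector fields, extended complex bilinearly. -/
def CField.bracket (X Y : CField ℓ n) : CField ℓ n where
  re p := VectorField.lieBracket ℝ X.re Y.re p - VectorField.lieBracket ℝ X.im Y.im p
  im p := VectorField.lieBracket ℝ X.re Y.im p + VectorField.lieBracket ℝ X.im Y.re p

/-- `X` is defined and of class `C^s` near `p`, and at every point of `M` near `p` both its real
and imaginary part are tangent to `M`. (The restriction of `X` to `M` is a section of `ℂ ⊗ TM`,
every section of class `C^s` of this bundle arises in this way near `p`, and on `M` the bracket of
two such fields depends only on their restrictions to `M`.) The predicate `type` is imposed on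
the values of `X` on `M`. -/
def IsTangentField (Ω : Set (Base ℓ n)) (h : Base ℓ n → ZIdx ℓ → ℝ) (s : ℕ∞) (p : Amb ℓ n)
    (type : Amb ℓ n → Amb ℓ n → Prop) (X : CField ℓ n) : Prop :=
  ∃ O : Set (Amb ℓ n), IsOpen O ∧ p ∈ O ∧
    ContDiffOn ℝ (s : WithTop ℕ∞) X.re O ∧ ContDiffOn ℝ (s : WithTop ℕ∞) X.im O ∧
    ∀ q ∈ graphSet Ω h ∩ O,
      X.re q ∈ tangent h q ∧ X.im q ∈ tangent h q ∧ type (X.re q) (X.im q)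

/-- Local sections of `T^{1,0} M` of class `C^s`: the vector `u + i v` is of type `(1,0)` when
`v = -J u`. -/
def IsHolField (Ω : Set (Base ℓ n)) (h : Base ℓ n → ZIdx ℓ → ℝ) (s : ℕ∞) (p : Amb ℓ n)
    (X : CField ℓ n) : Prop :=
  IsTangentField Ω h s p (fun u v => v = -(Complex.I • u)) X

/-- Local sections of `T^{0,1} M` of class `C^s`: the vector `u + i v` is of type `(0,1)` when
`v = J u`. -/
def IsAntiholField (Ω : Set (Base ℓ n)) (h : Base ℓ n → ZIdx ℓ → ℝ) (s : ℕ∞) (p : Amb ℓ n)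
    (X : CField ℓ n) : Prop :=
  IsTangentField Ω h s p (fun u v => v = Complex.I • u) X

/-- `IsIterBracket Ω h s p k X`: near `p`, the field `X` is an iterated Lie bracket of `k`
sections of `T^{1,0} M` or `T^{0,1} M` of class `C^s` (a single section if `k = 1`). -/
inductive IsIterBracket (Ω : Set (Base ℓ n)) (h : Base ℓ n → ZIdx ℓ → ℝ) (s : ℕ∞)
    (p : Amb ℓ n) : ℕ → CField ℓ n → Prop
  | hol (X : CField ℓ n) : IsHolField Ω h s p X → IsIterBracket Ω h s p 1 X
  | antihol (X : CField ℓ n) : IsAntiholField Ω h s p X → IsIterBracket Ω h s p 1 X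
  | bracket (j k : ℕ) (X Y : CField ℓ n) : IsIterBracket Ω h s p j X →
      IsIterBracket Ω h s p k Y → IsIterBracket Ω h s p (j + k) (X.bracket Y)

/-- `ℒ^j_p`: the complex span of the values at `p` of the iterated brackets of length `≤ j`. For
`j = +∞` all lengths are allowed. -/
def bracketSpace (Ω : Set (Base ℓ n)) (h : Base ℓ n → ZIdx ℓ → ℝ) (s : ℕ∞) (p : Amb ℓ n)
    (j : ℕ∞) : Submodule ℂ (ℂ ⊗[ℝ] Amb ℓ n) :=
  Submodule.span ℂ {v | ∃ (k : ℕ) (X : CField ℓ n),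
    (k : ℕ∞) ≤ j ∧ IsIterBracket Ω h s p k X ∧ v = X.val p}

/-- The vectors of the real tangent space `T_p M` that lie in `ℒ^j_p`. -/
def realBracketSpace (Ω : Set (Base ℓ n)) (h : Base ℓ n → ZIdx ℓ → ℝ) (s : ℕ∞) (p : Amb ℓ n)
    (j : ℕ∞) : Submodule ℝ (tangent h p) :=
  (((bracketSpace Ω h s p j).restrictScalars ℝ).comap
    (TensorProduct.mk ℝ ℂ (Amb ℓ n) 1)).comap (tangent h p).subtype

end Fields

/-! ### Coordinate vectors -/

section Coordinates

variable {r : ℕ} (ℓ : Fin r → ℕ) (n : ℕ)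

/-- The coordinate vector `∂_{x_a}`. -/
def dX (a : ZIdx ℓ) : ℂ ⊗[ℝ] Amb ℓ n :=
  (1 : ℂ) ⊗ₜ[ℝ] ((Pi.single a 1, 0) : Amb ℓ n)

/-- The vector `∂_{w_b} = (∂_{Re w_b} - i ∂_{Im w_b}) / 2`. -/
def dW (b : Fin n) : ℂ ⊗[ℝ] Amb ℓ n :=
  (1 / 2 : ℂ) ⊗ₜ[ℝ] ((0, Pi.single b 1) : Amb ℓ n)
    - (Complex.I / 2) ⊗ₜ[ℝ] ((0, Pi.single b Complex.I) : Amb ℓ n)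

/-- The vector `∂̄_{w_b} = (∂_{Re w_b} + i ∂_{Im w_b}) / 2`. -/
def dWbar (b : Fin n) : ℂ ⊗[ℝ] Amb ℓ n :=
  (1 / 2 : ℂ) ⊗ₜ[ℝ] ((0, Pi.single b 1) : Amb ℓ n)
    + (Complex.I / 2) ⊗ₜ[ℝ] ((0, Pi.single b Complex.I) : Amb ℓ n)

/-- The complex span of `∂_w`, `∂̄_w` and of `∂_{x_{I_j}}` for the blocks `j < i`. -/
def coordSpan (i : Fin r) : Submodule ℂ (ℂ ⊗[ℝ] Amb ℓ n) :=
  Submodule.span ℂ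
    (Set.range (dW ℓ n) ∪ Set.range (dWbar ℓ n) ∪ {v | ∃ a : ZIdx ℓ, a.1 < i ∧ v = dX ℓ n a})

end Coordinates

end CRBracket

end

noncomputable section

namespace CRBracket

/-! ### Weighted order of vanishing in terms of derivatives -/

section WeightedOrder

variable {E σ : Type*} [NormedAddCommGroup E] [NormedSpace ℝ E]

/-! Give x_a the weight of its block and the real coordinates of w the weight 1. A field on the base
has weight at least -k when its coefficient along each coordinate of weight μ has weighted order at
least μ - k. A bracket of fields of weights at least -j and -k has weight at least -(j + k). At the
origin, a coefficient of positive order vanishes, so a bracket of length k has no component along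
coordinates of weight greater than k. For k ≤ m_i - 1 this removes every block from I_i on.

The starting point is that sections of type (1,0) or (0,1) have weight at least -1
(`HasBracketWeight.of_tangent_complex`): U and JU are both tangent, so their x_a-coefficients are
obtained from all coefficients of JU and U through dh_a, and a bootstrap on this coupled system
raises their order. The bracket step is `HasWeightedOrder.coord_lieBracket`, transported to the
graph by `proj_lieBracket`.

With finite regularity there is no Taylor series to grade, so weighted order means that derivatives
of low weight vanish at 0; `HasWeightedOrder.of_isBigO` extracts this from the growth condition
along dilations. Infinite weights and infinite regularity become finite once the length of the
bracket is fixed. Finally, ∂ρ_a(Jv) = -Re v_a / 2 on the tangent space at 0, which gives the map on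
the quotient. -/

/-- The iterated derivative of `f` in the directions `b α`, where `α` runs through a list. -/
def iterDirDeriv (b : σ → E) : List σ → (E → ℝ) → E → ℝ
  | [], f => f
  | α :: L, f => iterDirDeriv b L (fun x => fderiv ℝ f x (b α))

/-- All derivatives of `f` at `0` of weight less than `d` vanish; the derivative in the direction
`b α` has weight `w α`. -/
def HasWeightedOrder (b : σ → E) (w : σ → ℕ) (d : ℕ) (f : E → ℝ) : Prop :=
  ∀ L : List σ, (L.map w).sum < d → iterDirDeriv b L f 0 = 0

variable {b : σ → E} {w : σ → ℕ} {f g : E → ℝ} {d : ℕ}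

theorem iterDirDeriv_congr (L : List σ) {x : E} (hfg : f =ᶠ[𝓝 x] g) :
    iterDirDeriv b L f =ᶠ[𝓝 x] iterDirDeriv b L g := by
  induction L generalizing f g with
  | nil => exact hfg
  | cons α L ih =>
    exact ih ((hfg.fderiv (𝕜 := ℝ)).mono fun y hy => by simp only [hy])

theorem contDiffAt_dirDeriv {p : ℕ} {x : E} (hf : ContDiffAt ℝ (p + 1 : ℕ) f x) (v : E) :
    ContDiffAt ℝ p (fun y => fderiv ℝ f y v) x :=
  (hf.fderiv_right (m := p) (by norm_cast)).clm_apply contDiffAt_const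

theorem continuousAt_iterDirDeriv (L : List σ) {x : E} (hf : ContDiffAt ℝ L.length f x) :
    ContinuousAt (iterDirDeriv b L f) x := by
  induction L generalizing f with
  | nil => exact hf.continuousAt
  | cons α L ih => exact ih (contDiffAt_dirDeriv hf _)

theorem eventually_differentiableAt {F : Type*} [NormedAddCommGroup F] [NormedSpace ℝ F]
    {f : E → F} {p : ℕ} {x : E} (hp : p ≠ 0) (hf : ContDiffAt ℝ p f x) :
    ∀ᶠ y in 𝓝 x, DifferentiableAt ℝ f y :=
  (hf.eventually (by simp)).mono fun _ hy => hy.differentiableAt (by exact_mod_cast hp)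

namespace HasWeightedOrder

theorem zero : HasWeightedOrder b w 0 f := fun _ h => absurd h (by simp)

theorem mono {d' : ℕ} (hf : HasWeightedOrder b w d f) (h : d' ≤ d) : HasWeightedOrder b w d' f :=
  fun L hL => hf L (hL.trans_le h)

theorem congr (hf : HasWeightedOrder b w d f) (hfg : f =ᶠ[𝓝 0] g) : HasWeightedOrder b w d g :=
  fun L hL => by rw [← (iterDirDeriv_congr L hfg).eq_of_nhds]; exact hf L hL

/-- This recursion lets the closure properties be proved by induction on the number of available
derivatives. Truncated subtraction makes the condition empty once a direction outweighs `d`. -/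
theorem iff_dirDeriv : HasWeightedOrder b w d f ↔ (0 < d → f 0 = 0) ∧
    ∀ α, HasWeightedOrder b w (d - w α) (fun x => fderiv ℝ f x (b α)) := by
  constructor
  · intro h
    refine ⟨fun hd => h [] (by simpa using hd), fun α L hL => h (α :: L) ?_⟩
    simp only [List.map_cons, List.sum_cons]
    omega
  · rintro ⟨h0, h1⟩ L hL
    cases L with
    | nil => exact h0 (by simpa using hL)
    | cons α L =>
      simp only [List.map_cons, List.sum_cons] at hL
      exact h1 α L (by omega)

theorem apply_zero (hf : HasWeightedOrder b w d f) (hd : 0 < d) : f 0 = 0 :=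
  (iff_dirDeriv.1 hf).1 hd

theorem dirDeriv (hf : HasWeightedOrder b w d f) (α : σ) :
    HasWeightedOrder b w (d - w α) (fun x => fderiv ℝ f x (b α)) :=
  (iff_dirDeriv.1 hf).2 α

theorem of_apply_zero (hw : ∀ α, 0 < w α) (hf : f 0 = 0) : HasWeightedOrder b w 1 f :=
  iff_dirDeriv.2 ⟨fun _ => hf, fun α => by
    rw [Nat.sub_eq_zero_of_le (hw α)]; exact zero⟩

theorem const_zero : HasWeightedOrder b w d (fun _ => 0) := by
  intro L hL
  suffices ∀ x, iterDirDeriv b L (fun _ => (0 : ℝ)) x = 0 from this 0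
  clear hL
  induction L with
  | nil => intro x; rfl
  | cons α L ih => intro x; simpa [iterDirDeriv] using ih x

/-- Weights are positive, so each derivative lowers `d` by at least one (or leaves it at 0) while
`p` drops by one; the bound `d ≤ p` survives the induction. -/
theorem add (hw : ∀ α, 0 < w α) {p : ℕ} (hd : d ≤ p) (hf : HasWeightedOrder b w d f)
    (hg : HasWeightedOrder b w d g) (cf : ContDiffAt ℝ p f 0) (cg : ContDiffAt ℝ p g 0) :
    HasWeightedOrder b w d (fun x => f x + g x) := by
  induction p generalizing d f g with
  | zero => obtain rfl : d = 0 := by omega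
            exact zero
  | succ p ih =>
    refine iff_dirDeriv.2 ⟨fun h => by simp [hf.apply_zero h, hg.apply_zero h], fun α => ?_⟩
    refine (ih (by have := hw α; omega) (hf.dirDeriv α) (hg.dirDeriv α)
      (contDiffAt_dirDeriv cf _) (contDiffAt_dirDeriv cg _)).congr ?_
    filter_upwards [eventually_differentiableAt p.succ_ne_zero cf,
      eventually_differentiableAt p.succ_ne_zero cg] with x hx hy
    rw [fderiv_fun_add hx hy]
    rfl

theorem neg (hf : HasWeightedOrder b w d f) : HasWeightedOrder b w d (fun x => -f x) := by
  intro L hL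
  suffices ∀ x, iterDirDeriv b L (fun y => -f y) x = -iterDirDeriv b L f x by
    rw [this, hf L hL, neg_zero]
  clear hL hf
  induction L generalizing f with
  | nil => intro x; rfl
  | cons α L ih =>
    intro x
    simp only [iterDirDeriv]
    rw [← ih]
    simp [fderiv_fun_neg]

theorem sum (hw : ∀ α, 0 < w α) {p : ℕ} (hd : d ≤ p) {ι : Type*} (s : Finset ι) {F : ι → E → ℝ}
    (hF : ∀ i, HasWeightedOrder b w d (F i)) (cF : ∀ i, ContDiffAt ℝ p (F i) 0) :
    HasWeightedOrder b w d (fun x => ∑ i ∈ s, F i x) := by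
  classical
  induction s using Finset.induction_on with
  | empty => simpa using const_zero
  | insert i s hi ih =>
    simp only [Finset.sum_insert hi]
    exact (hF i).add hw hd ih (cF i) (ContDiffAt.sum fun j _ => cF j)

/-- Leibniz rule. The order `d` is kept separate from `d₁ + d₂`, which may exceed the available
regularity. -/
theorem mul (hw : ∀ α, 0 < w α) {p d₁ d₂ : ℕ} (hd : d ≤ p) (hd' : d ≤ d₁ + d₂)
    (hf : HasWeightedOrder b w d₁ f) (hg : HasWeightedOrder b w d₂ g)
    (cf : ContDiffAt ℝ p f 0) (cg : ContDiffAt ℝ p g 0) :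
    HasWeightedOrder b w d (fun x => f x * g x) := by
  induction p generalizing d d₁ d₂ f g with
  | zero => obtain rfl : d = 0 := by omega
            exact zero
  | succ p ih =>
    refine iff_dirDeriv.2 ⟨fun h => ?_, fun α => ?_⟩
    · rcases Nat.eq_zero_or_pos d₁ with h1 | h1
      · simp [hg.apply_zero (by omega)]
      · simp [hf.apply_zero h1]
    have hα := hw α
    have cf' : ContDiffAt ℝ p f 0 := cf.of_le (by exact_mod_cast p.le_succ)
    have cg' : ContDiffAt ℝ p g 0 := cg.of_le (by exact_mod_cast p.le_succ)
    have h1 := ih (d := d - w α) (by omega) (by omega) hf (hg.dirDeriv α) cf'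
      (contDiffAt_dirDeriv cg _)
    have h2 := ih (d := d - w α) (by omega) (by omega) hg (hf.dirDeriv α) cg'
      (contDiffAt_dirDeriv cf _)
    refine (h1.add hw (by omega) h2 (cf'.mul (contDiffAt_dirDeriv cg _))
      (cg'.mul (contDiffAt_dirDeriv cf _))).congr ?_
    filter_upwards [eventually_differentiableAt p.succ_ne_zero cf,
      eventually_differentiableAt p.succ_ne_zero cg] with x hx hy
    rw [fderiv_fun_mul hx hy]
    rfl

end HasWeightedOrder

end WeightedOrder

/-! ### Iterated finite differences -/

section FiniteDifferences

variable {E σ : Type*} [NormedAddCommGroup E] [NormedSpace ℝ E]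

/-- The iterated finite difference of `f` with steps `c α • b α`. -/
def iterDiff (b : σ → E) (c : σ → ℝ) : List σ → (E → ℝ) → E → ℝ
  | [], f, x => f x
  | α :: L, f, x => iterDiff b c L f (x + c α • b α) - iterDiff b c L f x

/-- The total length of the steps of an iterated finite difference. -/
def stepLength (b : σ → E) (c : σ → ℝ) (L : List σ) : ℝ := (L.map fun α => ‖c α • b α‖).sum

variable {b : σ → E} {c : σ → ℝ} {f : E → ℝ}

/-- An iterated difference is a combination of translates, so it commutes with differentiation; the
bound with `stepLength` keeps every sample point in the ball. -/
theorem hasDerivAt_iterDiff (L : List σ) {R : ℝ} (hf : ∀ x, ‖x‖ < R → DifferentiableAt ℝ f x)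
    (y v : E) (θ : ℝ) (hy : ‖y + θ • v‖ + stepLength b c L < R) :
    HasDerivAt (fun t : ℝ => iterDiff b c L f (y + t • v))
      (iterDiff b c L (fun x => fderiv ℝ f x v) (y + θ • v)) θ := by
  induction L generalizing y with
  | nil =>
    have h1 : HasDerivAt (fun t : ℝ => y + t • v) v θ := by
      simpa using ((hasDerivAt_id θ).smul_const v).const_add y
    exact (hf _ (by simpa [stepLength] using hy)).hasFDerivAt.comp_hasDerivAt θ h1
  | cons α L ih =>
    have hL : stepLength b c (α :: L) = ‖c α • b α‖ + stepLength b c L := rfl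
    rw [hL] at hy
    have h1 := ih (y + c α • b α) (by
      have := norm_add_le (y + θ • v) (c α • b α)
      rw [add_right_comm]
      linarith)
    have h2 := ih y (by linarith [norm_nonneg (c α • b α)])
    simp only [add_right_comm y (c α • b α)] at h1
    exact h1.sub h2

/-- An iterated mean value theorem. -/
theorem exists_iterDiff_eq (L : List σ) {R : ℝ} (hf : ∀ x, ‖x‖ < R → ContDiffAt ℝ L.length f x)
    (y : E) (hy : ‖y‖ + stepLength b c L < R) :
    ∃ ξ, ‖ξ‖ ≤ ‖y‖ + stepLength b c L ∧
      iterDiff b c L f y = (L.map c).prod * iterDirDeriv b L f ξ := by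
  induction L generalizing f y with
  | nil => exact ⟨y, by simp [stepLength], by simp [iterDiff, iterDirDeriv]⟩
  | cons α L ih =>
    have hL : stepLength b c (α :: L) = ‖c α • b α‖ + stepLength b c L := rfl
    rw [hL] at hy ⊢
    have hfd : ∀ x, ‖x‖ < R → DifferentiableAt ℝ f x := fun x hx =>
      (hf x hx).differentiableAt (by simp)
    have key : ∀ θ ∈ Set.Icc (0 : ℝ) 1, ‖y + θ • (c α • b α)‖ ≤ ‖y‖ + ‖c α • b α‖ := by
      intro θ hθ
      refine (norm_add_le _ _).trans ?_
      rw [norm_smul θ, Real.norm_of_nonneg hθ.1]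
      have := mul_le_mul_of_nonneg_right hθ.2 (norm_nonneg (c α • b α))
      linarith
    have hder : ∀ θ ∈ Set.Icc (0 : ℝ) 1, HasDerivAt
        (fun t : ℝ => iterDiff b c L f (y + t • (c α • b α)))
        (iterDiff b c L (fun x => fderiv ℝ f x (c α • b α)) (y + θ • (c α • b α))) θ :=
      fun θ hθ => hasDerivAt_iterDiff L hfd y _ θ (by have := key θ hθ; linarith)
    -- The mean value theorem along the outermost step trades one difference for one derivative.
    obtain ⟨θ, hθ, hθ'⟩ := exists_hasDerivAt_eq_slope
      (fun t : ℝ => iterDiff b c L f (y + t • (c α • b α))) _ one_pos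
      (fun t ht => (hder t ht).continuousAt.continuousWithinAt)
      (fun t ht => hder t (Set.Ioo_subset_Icc_self ht))
    have hk := key θ (Set.Ioo_subset_Icc_self hθ)
    obtain ⟨ξ, hξ, hξ'⟩ := ih (f := fun x => fderiv ℝ f x (b α))
      (fun x hx => contDiffAt_dirDeriv (hf x hx) _) (y + θ • (c α • b α)) (by linarith)
    refine ⟨ξ, by linarith, ?_⟩
    have hscale : ∀ (L : List σ) (k : ℝ) (F : E → ℝ) (x : E),
        iterDiff b c L (fun z => k * F z) x = k * iterDiff b c L F x := by
      intro L k F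
      induction L with
      | nil => intro x; rfl
      | cons β L ih => intro x; simp only [iterDiff, ih]; ring
    simp only [map_smul, smul_eq_mul, hscale, one_smul, zero_smul, add_zero, sub_zero,
      div_one] at hθ'
    simp only [iterDiff, List.map_cons, List.prod_cons, iterDirDeriv]
    rw [← hθ', hξ']
    ring

/-- If `f (δ_t x) = O(t ^ d)` pointwise for the dilations `δ_t`, then all derivatives of `f` at `0`
of weight less than `d` vanish. -/
theorem HasWeightedOrder.of_isBigO {w : σ → ℕ} (hw : ∀ α, 0 < w α) {d p : ℕ} (hd : d ≤ p)
    (hf : ContDiffAt ℝ p f 0) (δ : ℝ → E → E) (δ_zero : ∀ t, δ t 0 = 0)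
    (δ_add : ∀ t x α, δ t (x + b α) = δ t x + t ^ w α • b α)
    (hO : ∀ x, (fun t => f (δ t x)) =O[𝓝 0] fun t : ℝ => t ^ d) :
    HasWeightedOrder b w d f := by
  intro L hL
  -- Weights are at least 1, so a list of weight below `d ≤ p` uses fewer than `p` derivatives.
  have hlen : L.length ≤ (L.map w).sum := by
    clear hL
    induction L with
    | nil => simp
    | cons α L ih => have := hw α; simp only [List.length_cons, List.map_cons, List.sum_cons]; omega
  have hfL : ContDiffAt ℝ L.length f 0 := hf.of_le (by exact_mod_cast (by omega : L.length ≤ p))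
  -- With steps t ^ w α, every sample point is the dilate of a fixed point, so the pointwise
  -- hypothesis applies to each of the finitely many terms.
  have hO' : (fun t => iterDiff b (fun α => t ^ w α) L f 0) =O[𝓝 0] fun t : ℝ => t ^ d := by
    suffices ∀ x, (fun t => iterDiff b (fun α => t ^ w α) L f (δ t x)) =O[𝓝 0]
        fun t : ℝ => t ^ d by simpa [δ_zero] using this 0
    clear hL hlen hfL
    induction L with
    | nil => exact hO
    | cons α L ih =>
      intro x
      simp only [iterDiff, ← δ_add]
      exact (ih _).sub (ih _)
  obtain ⟨R, hR, hball⟩ := Metric.eventually_nhds_iff_ball.1 (hfL.eventually (by simp))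
  have hstep : Filter.Tendsto (fun t : ℝ => stepLength b (fun α => t ^ w α) L) (𝓝 0) (𝓝 0) := by
    clear hL hlen hfL hball hO'
    induction L with
    | nil => simp [stepLength]
    | cons α L ih =>
      have h1 : Filter.Tendsto (fun t : ℝ => ‖t ^ w α • b α‖) (𝓝 0) (𝓝 0) := by
        have : Continuous fun t : ℝ => ‖t ^ w α • b α‖ := by fun_prop
        simpa [(hw α).ne'] using this.tendsto 0
      simpa [stepLength] using h1.add ih
  -- The same difference is t ^ (weight of `L`) times a derivative at a point tending to 0. Dividing
  -- the O(t ^ d) bound by this power leaves a positive power of t, which forces the derivative at 0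
  -- to vanish.
  have hex : ∀ᶠ t : ℝ in 𝓝 0, ∃ ξ, ‖ξ‖ ≤ stepLength b (fun α => t ^ w α) L ∧
      iterDiff b (fun α => t ^ w α) L f 0 = t ^ (L.map w).sum * iterDirDeriv b L f ξ := by
    filter_upwards [hstep.eventually_lt_const hR] with t ht
    obtain ⟨ξ, h1, h2⟩ := exists_iterDiff_eq (b := b) (c := fun α => t ^ w α) L
      (fun x hx => hball x (by simpa using hx)) 0 (by simpa using ht)
    refine ⟨ξ, by simpa using h1, ?_⟩
    rw [h2]
    congr 1
    clear hL hlen hfL hball hO' hstep ht h1 h2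
    induction L with
    | nil => simp
    | cons α L ih => simp [pow_add, ih]
  obtain ⟨C, hC⟩ := hO'.bound
  choose! ξ hξ using fun t : ℝ => fun (h : ∃ ξ, ‖ξ‖ ≤ stepLength b (fun α => t ^ w α) L ∧
      iterDiff b (fun α => t ^ w α) L f 0 = t ^ (L.map w).sum * iterDirDeriv b L f ξ) => h
  have hξ0 : Filter.Tendsto ξ (𝓝 0) (𝓝 0) :=
    squeeze_zero_norm' (hex.mono fun t ht => (hξ t ht).1) hstep
  have hlim : Filter.Tendsto (fun t => iterDirDeriv b L f (ξ t)) (𝓝[≠] 0)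
      (𝓝 (iterDirDeriv b L f 0)) :=
    ((continuousAt_iterDirDeriv L hfL).tendsto.comp hξ0).mono_left nhdsWithin_le_nhds
  refine tendsto_nhds_unique hlim (squeeze_zero_norm' (a := fun t : ℝ =>
    C * |t| ^ (d - (L.map w).sum)) ?_ ?_)
  · filter_upwards [nhdsWithin_le_nhds hex, nhdsWithin_le_nhds hC, self_mem_nhdsWithin]
      with t h1 h2 h3
    have ht : 0 < |t| ^ (L.map w).sum := pow_pos (abs_pos.2 h3) _
    rw [(hξ t h1).2, norm_mul, norm_pow, norm_pow, Real.norm_eq_abs t,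
      ← Nat.add_sub_of_le hL.le, pow_add, ← mul_assoc, mul_comm C, mul_assoc] at h2
    exact le_of_mul_le_mul_left h2 ht
  · have : Continuous fun t : ℝ => C * |t| ^ (d - (L.map w).sum) := by fun_prop
    have h0 := this.tendsto 0
    simp only [abs_zero, zero_pow (by omega : d - (L.map w).sum ≠ 0), mul_zero] at h0
    exact h0.mono_left nhdsWithin_le_nhds

end FiniteDifferences

/-! ### Brackets of weighted vector fields -/

section WeightedBracket

variable {E σ : Type*} [NormedAddCommGroup E] [NormedSpace ℝ E] [FiniteDimensional ℝ E]

theorem contDiffAt_basis_coord (b : Module.Basis σ ℝ E) {F : Type*} [NormedAddCommGroup F]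
    [NormedSpace ℝ F] {p : WithTop ℕ∞} {V : F → E} {x : F} (hV : ContDiffAt ℝ p V x) (α : σ) :
    ContDiffAt ℝ p (fun y => b.coord α (V y)) x :=
  (LinearMap.toContinuousLinearMap (b.coord α)).contDiff.contDiffAt.comp x hV

/-- In V(W^α) = ∑ V^β ∂_β W^α the factors have orders w β - j and w α - k - w β: the weight of β
cancels, and truncation can only increase the sum. -/
theorem HasWeightedOrder.coord_fderiv_apply [Fintype σ] (b : Module.Basis σ ℝ E) {w : σ → ℕ}
    (hw : ∀ α, 0 < w α) {V W : E → E} {p j k : ℕ} (cV : ContDiffAt ℝ (p + 1 : ℕ) V 0)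
    (cW : ContDiffAt ℝ (p + 1 : ℕ) W 0)
    (hV : ∀ α, HasWeightedOrder b w (w α - j) fun x => b.coord α (V x))
    (hW : ∀ α, HasWeightedOrder b w (w α - k) fun x => b.coord α (W x))
    (α : σ) (hp : w α - (j + k) ≤ p) :
    HasWeightedOrder b w (w α - (j + k)) fun x => b.coord α (fderiv ℝ W x (V x)) := by
  have hle : ((p : ℕ) : WithTop ℕ∞) ≤ (p + 1 : ℕ) := by exact_mod_cast p.le_succ
  refine (HasWeightedOrder.sum (b := b) (w := w) hw hp Finset.univ
    (F := fun β x => b.coord β (V x) * fderiv ℝ (fun y => b.coord α (W y)) x (b β))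
    (fun β => ?_) fun β => ?_).congr ?_
  · exact (hV β).mul hw hp (by omega) ((hW α).dirDeriv β) ((contDiffAt_basis_coord b cV β).of_le hle)
      (contDiffAt_dirDeriv (contDiffAt_basis_coord b cW α) _)
  · exact ((contDiffAt_basis_coord b cV β).of_le hle).mul
      (contDiffAt_dirDeriv (contDiffAt_basis_coord b cW α) _)
  · filter_upwards [eventually_differentiableAt p.succ_ne_zero cW] with x hx
    have h1 : fderiv ℝ (fun y => b.coord α (W y)) x
        = (LinearMap.toContinuousLinearMap (b.coord α)).comp (fderiv ℝ W x) :=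
      ((LinearMap.toContinuousLinearMap (b.coord α)).hasFDerivAt.comp x hx.hasFDerivAt).fderiv
    have h2 : V x = ∑ β, b.coord β (V x) • b β := (b.sum_repr (V x)).symm
    conv_rhs => rw [h2, map_sum, map_sum]
    refine Finset.sum_congr rfl fun β _ => ?_
    rw [h1, map_smul, map_smul]
    rfl

theorem contDiffAt_lieBracket {F : Type*} [NormedAddCommGroup F] [NormedSpace ℝ F] {V W : F → F}
    {x : F} {p : ℕ} (cV : ContDiffAt ℝ (p + 1 : ℕ) V x) (cW : ContDiffAt ℝ (p + 1 : ℕ) W x) :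
    ContDiffAt ℝ p (VectorField.lieBracket ℝ V W) x :=
  cV.lieBracket_vectorField cW (by simp)

theorem HasWeightedOrder.coord_lieBracket [Fintype σ] (b : Module.Basis σ ℝ E) {w : σ → ℕ}
    (hw : ∀ α, 0 < w α) {V W : E → E} {p j k : ℕ} (cV : ContDiffAt ℝ (p + 1 : ℕ) V 0)
    (cW : ContDiffAt ℝ (p + 1 : ℕ) W 0)
    (hV : ∀ α, HasWeightedOrder b w (w α - j) fun x => b.coord α (V x))
    (hW : ∀ α, HasWeightedOrder b w (w α - k) fun x => b.coord α (W x))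
    (α : σ) (hp : w α - (j + k) ≤ p) :
    HasWeightedOrder b w (w α - (j + k)) fun x =>
      b.coord α (VectorField.lieBracket ℝ V W x) := by
  have hle : ((p : ℕ) : WithTop ℕ∞) ≤ (p + 1 : ℕ) := by exact_mod_cast p.le_succ
  have c1 : ContDiffAt ℝ p (fun x => fderiv ℝ W x (V x)) 0 :=
    (cW.fderiv_right (by norm_cast)).clm_apply (cV.of_le hle)
  have c2 : ContDiffAt ℝ p (fun x => fderiv ℝ V x (W x)) 0 :=
    (cV.fderiv_right (by norm_cast)).clm_apply (cW.of_le hle)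
  have h2 := HasWeightedOrder.coord_fderiv_apply b hw cW cV hW hV α (by omega)
  rw [add_comm k j] at h2
  have := (HasWeightedOrder.coord_fderiv_apply b hw cV cW hV hW α hp).add hw hp h2.neg
    (contDiffAt_basis_coord b c1 α) (contDiffAt_basis_coord b c2 α).neg
  refine this.congr (Filter.Eventually.of_forall fun x => ?_)
  simp [VectorField.lieBracket_eq, sub_eq_add_neg]

end WeightedBracket

/-! ### Brackets of fields tangent to a graph -/

section Pullback

variable {A B : Type*} [NormedAddCommGroup A] [NormedSpace ℝ A] [NormedAddCommGroup B]
  [NormedSpace ℝ B] {Φ : B → A} {π : A →L[ℝ] B} {V W : A → A} {q : B}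

theorem fderiv_proj_comp (hΦ : DifferentiableAt ℝ Φ q) (hW : DifferentiableAt ℝ W (Φ q)) (u : B) :
    fderiv ℝ (fun x => π (W (Φ x))) q u = π (fderiv ℝ W (Φ q) (fderiv ℝ Φ q u)) := by
  have := (π.hasFDerivAt (x := W (Φ q))).comp q (hW.hasFDerivAt.comp q hΦ.hasFDerivAt)
  exact congrArg (fun T => T u) this.fderiv

/-- Differentiating along a vector tangent to the image of `Φ` only sees the restriction to that
image. -/
theorem proj_lieBracket (hΦ : DifferentiableAt ℝ Φ q) (dV : DifferentiableAt ℝ V (Φ q))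
    (dW : DifferentiableAt ℝ W (Φ q)) (hV : V (Φ q) = fderiv ℝ Φ q (π (V (Φ q))))
    (hW : W (Φ q) = fderiv ℝ Φ q (π (W (Φ q)))) :
    π (VectorField.lieBracket ℝ V W (Φ q)) =
      VectorField.lieBracket ℝ (fun x => π (V (Φ x))) (fun x => π (W (Φ x))) q := by
  simp only [VectorField.lieBracket_eq, map_sub]
  rw [fderiv_proj_comp hΦ dV, fderiv_proj_comp hΦ dW, ← hV, ← hW]

theorem fderiv_apply_of_tangent (hΦ : ContDiffAt ℝ 2 Φ q) (dW : DifferentiableAt ℝ W (Φ q))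
    (hW : ∀ᶠ x in 𝓝 q, W (Φ x) = fderiv ℝ Φ x (π (W (Φ x)))) (u : B) :
    fderiv ℝ W (Φ q) (fderiv ℝ Φ q u) =
      fderiv ℝ (fderiv ℝ Φ) q u (π (W (Φ q))) +
        fderiv ℝ Φ q (fderiv ℝ (fun x => π (W (Φ x))) q u) := by
  have dΦ : DifferentiableAt ℝ Φ q := hΦ.differentiableAt (by simp)
  have dΦ' : DifferentiableAt ℝ (fderiv ℝ Φ) q :=
    (hΦ.fderiv_right (m := 1) (by norm_num)).differentiableAt (by simp)
  have dWΦ : DifferentiableAt ℝ (fun x => W (Φ x)) q := dW.comp q dΦ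
  have dπ : DifferentiableAt ℝ (fun x => π (W (Φ x))) q := π.differentiableAt.comp q dWΦ
  have h1 : fderiv ℝ (fun x => W (Φ x)) q u = fderiv ℝ W (Φ q) (fderiv ℝ Φ q u) :=
    congrArg (fun T => T u) (dW.hasFDerivAt.comp q dΦ.hasFDerivAt).fderiv
  rw [← h1, Filter.EventuallyEq.fderiv_eq hW, fderiv_clm_apply dΦ' dπ]
  simp [add_comm]

/-- Differentiating W ∘ Φ = dΦ(π W) produces a second-derivative term of `Φ`, which cancels in the
bracket by symmetry. -/
theorem lieBracket_tangent (hΦ : ContDiffAt ℝ 2 Φ q) (dV : DifferentiableAt ℝ V (Φ q))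
    (dW : DifferentiableAt ℝ W (Φ q))
    (hV : ∀ᶠ x in 𝓝 q, V (Φ x) = fderiv ℝ Φ x (π (V (Φ x))))
    (hW : ∀ᶠ x in 𝓝 q, W (Φ x) = fderiv ℝ Φ x (π (W (Φ x)))) :
    VectorField.lieBracket ℝ V W (Φ q) =
      fderiv ℝ Φ q (π (VectorField.lieBracket ℝ V W (Φ q))) := by
  have dΦ : DifferentiableAt ℝ Φ q := hΦ.differentiableAt (by simp)
  have hsymm : IsSymmSndFDerivAt ℝ Φ q := hΦ.isSymmSndFDerivAt (by simp)
  have h1 := fderiv_apply_of_tangent hΦ dW hW (π (V (Φ q)))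
  have h2 := fderiv_apply_of_tangent hΦ dV hV (π (W (Φ q)))
  rw [proj_lieBracket dΦ dV dW hV.self_of_nhds hW.self_of_nhds]
  rw [← hV.self_of_nhds] at h1
  rw [← hW.self_of_nhds] at h2
  simp only [VectorField.lieBracket_eq, map_sub, h1, h2, hsymm.eq (π (V (Φ q))) (π (W (Φ q)))]
  abel

end Pullback

/-! ### The graph, its parametrization and weighted coordinates -/

section Graph

variable {r : ℕ} {ℓ : Fin r → ℕ} {n : ℕ}

/-- `toBase` as a continuous linear map. -/
def toBaseL (ℓ : Fin r → ℕ) (n : ℕ) : Amb ℓ n →L[ℝ] Base ℓ n :=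
  LinearMap.toContinuousLinearMap
    { toFun := toBase
      map_add' := fun _ _ => by ext <;> simp [toBase]
      map_smul' := fun _ _ => by ext <;> simp [toBase] }

@[simp] theorem toBaseL_apply (p : Amb ℓ n) : toBaseL ℓ n p = toBase p := rfl

/-- The linear map `(x, y, w) ↦ (x + i y, w)`. -/
def ofReIm (ℓ : Fin r → ℕ) (n : ℕ) : (Base ℓ n × (ZIdx ℓ → ℝ)) →L[ℝ] Amb ℓ n :=
  LinearMap.toContinuousLinearMap
    { toFun := fun p => (fun a => (p.1.1 a : ℂ) + Complex.I * (p.2 a : ℂ), p.1.2)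
      map_add' := fun _ _ => by
        ext
        · simp; ring
        · simp
      map_smul' := fun _ _ => by
        ext
        · simp; ring
        · simp }

theorem ofReIm_apply (x : Base ℓ n) (y : ZIdx ℓ → ℝ) :
    ofReIm ℓ n (x, y) = (fun a => (x.1 a : ℂ) + Complex.I * (y a : ℂ), x.2) := rfl

/-- The parametrization `(x, w) ↦ (x + i h(x, w), w)` of the graph of `h`. -/
def graphMap (h : Base ℓ n → ZIdx ℓ → ℝ) (q : Base ℓ n) : Amb ℓ n := ofReIm ℓ n (q, h q)

@[simp] theorem toBase_ofReIm (x : Base ℓ n) (y : ZIdx ℓ → ℝ) : toBase (ofReIm ℓ n (x, y)) = x := by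
  ext <;> simp [toBase, ofReIm_apply]

theorem ofReIm_toBase (p : Amb ℓ n) : ofReIm ℓ n (toBase p, fun a => (p.1 a).im) = p := by
  ext a
  · simp [ofReIm_apply, toBase, mul_comm Complex.I]
  · rfl

variable {h : Base ℓ n → ZIdx ℓ → ℝ} {Ω : Set (Base ℓ n)}

theorem graphMap_zero (h0 : h 0 = 0) : graphMap h 0 = 0 := by
  rw [graphMap, h0]
  exact map_zero _

theorem graphMap_mem_graphSet {q : Base ℓ n} (hq : q ∈ Ω) : graphMap h q ∈ graphSet Ω h := by
  refine ⟨by simpa [graphMap] using hq, fun a => ?_⟩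
  simp only [graphMap, toBase_ofReIm]
  simp [ofReIm_apply]

theorem contDiffAt_graphMap {p : WithTop ℕ∞} {q : Base ℓ n} (hh : ContDiffAt ℝ p h q) :
    ContDiffAt ℝ p (graphMap h) q :=
  (ofReIm ℓ n).contDiff.contDiffAt.comp q (contDiffAt_id.prodMk hh)

theorem fderiv_graphMap {q : Base ℓ n} (hh : DifferentiableAt ℝ h q) (v : Base ℓ n) :
    fderiv ℝ (graphMap h) q v = ofReIm ℓ n (v, fderiv ℝ h q v) := by
  have := ((ofReIm ℓ n).hasFDerivAt (x := (q, h q))).comp q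
    ((hasFDerivAt_id q).prodMk hh.hasFDerivAt)
  exact congrArg (fun T => T v) this.fderiv

theorem fderiv_defFun {p : Amb ℓ n} (hh : DifferentiableAt ℝ h (toBase p)) (a : ZIdx ℓ)
    (v : Amb ℓ n) :
    fderiv ℝ (defFun h a) p v = -(v.1 a).im + fderiv ℝ h (toBase p) (toBase v) a := by
  let im : Amb ℓ n →L[ℝ] ℝ := Complex.imCLM.comp
    ((ContinuousLinearMap.proj (R := ℝ) (φ := fun _ : ZIdx ℓ => ℂ) a).comp
      (ContinuousLinearMap.fst ℝ (ZIdx ℓ → ℂ) (Fin n → ℂ)))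
  have h1 : HasFDerivAt (fun p : Amb ℓ n => h (toBase p)) ((fderiv ℝ h (toBase p)).comp
      (toBaseL ℓ n)) p :=
    HasFDerivAt.comp (f := toBaseL ℓ n) p hh.hasFDerivAt (toBaseL ℓ n).hasFDerivAt
  have h2 := (im.hasFDerivAt (x := p)).neg.add (hasFDerivAt_pi'.1 h1 a)
  exact congrArg (fun T => T v) h2.fderiv

theorem mem_tangent_iff {p v : Amb ℓ n} (hh : DifferentiableAt ℝ h (toBase p)) :
    v ∈ tangent h p ↔ ∀ a, (v.1 a).im = fderiv ℝ h (toBase p) (toBase v) a := by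
  simp only [tangent, Submodule.mem_iInf, LinearMap.mem_ker, ContinuousLinearMap.coe_coe,
    fderiv_defFun hh, neg_add_eq_zero]

theorem eq_fderiv_graphMap {q : Base ℓ n} (hh : DifferentiableAt ℝ h q) {v : Amb ℓ n}
    (hv : v ∈ tangent h (graphMap h q)) : v = fderiv ℝ (graphMap h) q (toBase v) := by
  have hq : toBase (graphMap h q) = q := toBase_ofReIm _ _
  rw [mem_tangent_iff (by rwa [hq]), hq] at hv
  rw [fderiv_graphMap hh, ← funext hv, ofReIm_toBase]

/-- The real coordinates of `Base`. -/
abbrev RealIdx (ℓ : Fin r → ℕ) (n : ℕ) : Type := ZIdx ℓ ⊕ ((_ : Fin n) × Fin 2)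

/-- The standard real basis of `Base`. -/
def baseBasis (ℓ : Fin r → ℕ) (n : ℕ) : Module.Basis (RealIdx ℓ n) ℝ (Base ℓ n) :=
  (Pi.basisFun ℝ (ZIdx ℓ)).prod (Pi.basis fun _ : Fin n => Complex.basisOneI)

@[simp] theorem baseBasis_coord_inl (a : ZIdx ℓ) (v : Base ℓ n) :
    (baseBasis ℓ n).coord (Sum.inl a) v = v.1 a := by
  simp [baseBasis]

/-- The weights of the real coordinates: `μ i` on the block `I_i`, and `1` on the `w`-space. -/
def realWeight (ℓ : Fin r → ℕ) (n : ℕ) (μ : Fin r → ℕ) : RealIdx ℓ n → ℕ :=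
  Sum.elim (fun a => μ a.1) fun _ => 1

theorem realWeight_pos {μ : Fin r → ℕ} (hμ : ∀ i, 0 < μ i) (α : RealIdx ℓ n) :
    0 < realWeight ℓ n μ α := by
  cases α with
  | inl a => exact hμ a.1
  | inr c => exact one_pos

theorem dilation_zero (μ : Fin r → ℕ) (t : ℝ) : dilation μ t (0 : Base ℓ n) = 0 := by
  ext <;> simp [dilation]

theorem dilation_add_basis (μ : Fin r → ℕ) (t : ℝ) (x : Base ℓ n) (α : RealIdx ℓ n) :
    dilation μ t (x + baseBasis ℓ n α) =
      dilation μ t x + t ^ realWeight ℓ n μ α • baseBasis ℓ n α := by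
  cases α with
  | inl a =>
    ext c
    · simp only [dilation, baseBasis, realWeight, Module.Basis.prod_apply]
      by_cases hc : c = a
      · subst hc; simp [mul_add]
      · simp [hc]
    · simp [dilation, baseBasis, Module.Basis.prod_apply]
  | inr c =>
    ext d
    · simp [dilation, baseBasis, Module.Basis.prod_apply]
    · simp [dilation, baseBasis, realWeight, Module.Basis.prod_apply, mul_add]

/-! ### Fields of bounded weight along the graph -/

/-- `W` is of class `C^(S - k)` near `0`, tangent to the graph of `h` near `0`, and the coefficient
of its restriction to the graph in a coordinate of weight `μ` has weighted order `μ - k`. -/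
structure HasBracketWeight (h : Base ℓ n → ZIdx ℓ → ℝ) (μ : Fin r → ℕ) (S k : ℕ)
    (W : Amb ℓ n → Amb ℓ n) : Prop where
  contDiffAt : ContDiffAt ℝ (S - k : ℕ) W 0
  tangent : ∀ᶠ q in 𝓝 (0 : Base ℓ n),
    W (graphMap h q) = fderiv ℝ (graphMap h) q (toBaseL ℓ n (W (graphMap h q)))
  order : ∀ α, HasWeightedOrder (baseBasis ℓ n) (realWeight ℓ n μ) (realWeight ℓ n μ α - k)
    fun q => (baseBasis ℓ n).coord α (toBaseL ℓ n (W (graphMap h q)))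

variable {μ : Fin r → ℕ} {S : ℕ}

theorem contDiffAt_comp_graphMap {p : ℕ} (h0 : h 0 = 0) (hh : ContDiffAt ℝ S h 0) (hp : p ≤ S)
    {W : Amb ℓ n → Amb ℓ n} (hW : ContDiffAt ℝ p W 0) :
    ContDiffAt ℝ p (fun q => toBaseL ℓ n (W (graphMap h q))) 0 := by
  have h1 : ContDiffAt ℝ p (graphMap h) 0 :=
    (contDiffAt_graphMap hh).of_le (by exact_mod_cast hp)
  rw [← graphMap_zero h0] at hW
  exact (toBaseL ℓ n).contDiff.contDiffAt.comp _ (hW.comp 0 h1)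

namespace HasBracketWeight

theorem neg {k : ℕ} {W : Amb ℓ n → Amb ℓ n} (hW : HasBracketWeight h μ S k W) :
    HasBracketWeight h μ S k fun p => -W p where
  contDiffAt := hW.contDiffAt.neg
  tangent := hW.tangent.mono fun q hq => by rw [map_neg, map_neg, ← hq]
  order α := (hW.order α).neg.congr (.of_forall fun q => by simp only [map_neg])

theorem add (h0 : h 0 = 0) (hh : ContDiffAt ℝ S h 0) (hμ : ∀ i, 0 < μ i) (hμS : ∀ i, μ i ≤ S)
    (hS : 0 < S) {k : ℕ} {V W : Amb ℓ n → Amb ℓ n} (hV : HasBracketWeight h μ S k V)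
    (hW : HasBracketWeight h μ S k W) : HasBracketWeight h μ S k fun p => V p + W p where
  contDiffAt := hV.contDiffAt.add hW.contDiffAt
  tangent := by
    filter_upwards [hV.tangent, hW.tangent] with q h1 h2
    rw [map_add, map_add, ← h1, ← h2]
  order α := by
    have hα : realWeight ℓ n μ α ≤ S := by
      cases α with
      | inl a => exact hμS a.1
      | inr c => exact hS
    refine ((hV.order α).add (realWeight_pos hμ) (Nat.sub_le_sub_right hα k) (hW.order α)
      ?_ ?_).congr (.of_forall fun q => by simp only [map_add])
    · exact contDiffAt_basis_coord _ (contDiffAt_comp_graphMap h0 hh (Nat.sub_le _ _)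
        hV.contDiffAt) α
    · exact contDiffAt_basis_coord _ (contDiffAt_comp_graphMap h0 hh (Nat.sub_le _ _)
        hW.contDiffAt) α

theorem lieBracket (h0 : h 0 = 0) (hh : ContDiffAt ℝ S h 0) (hμ : ∀ i, 0 < μ i)
    (hμS : ∀ i, μ i ≤ S) {j k : ℕ} (hj : 0 < j) (hk : 0 < k) (hjk : j + k < S)
    {V W : Amb ℓ n → Amb ℓ n} (hV : HasBracketWeight h μ S j V)
    (hW : HasBracketWeight h μ S k W) :
    HasBracketWeight h μ S (j + k) (VectorField.lieBracket ℝ V W) := by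
  -- The bracket costs one derivative; as both lengths are at least 1, the budget S - (j + k)
  -- already accounts for it.
  have cV : ContDiffAt ℝ (S - (j + k) + 1 : ℕ) V 0 :=
    hV.contDiffAt.of_le (by exact_mod_cast (by omega : S - (j + k) + 1 ≤ S - j))
  have cW : ContDiffAt ℝ (S - (j + k) + 1 : ℕ) W 0 :=
    hW.contDiffAt.of_le (by exact_mod_cast (by omega : S - (j + k) + 1 ≤ S - k))
  have c2 : ContDiffAt ℝ (2 : ℕ) (graphMap h) 0 :=
    (contDiffAt_graphMap hh).of_le (by exact_mod_cast (by omega : 2 ≤ S))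
  have e2 : ∀ᶠ q in 𝓝 0, ContDiffAt ℝ (2 : ℕ) (graphMap h) q := c2.eventually (by simp)
  have hlim : Filter.Tendsto (graphMap h) (𝓝 0) (𝓝 0) := by
    have := c2.continuousAt.tendsto
    rwa [graphMap_zero h0] at this
  have dV := hlim.eventually (eventually_differentiableAt (Nat.succ_ne_zero _) cV)
  have dW := hlim.eventually (eventually_differentiableAt (Nat.succ_ne_zero _) cW)
  refine ⟨contDiffAt_lieBracket cV cW, ?_, fun α => ?_⟩
  · filter_upwards [e2, dV, dW, eventually_eventually_nhds.2 hV.tangent,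
      eventually_eventually_nhds.2 hW.tangent] with q h1 h2 h3 h4 h5
    exact lieBracket_tangent h1 h2 h3 h4 h5
  · have hα : realWeight ℓ n μ α ≤ S := by
      cases α with
      | inl a => exact hμS a.1
      | inr c => exact (by omega : 1 ≤ S)
    refine (HasWeightedOrder.coord_lieBracket (baseBasis ℓ n) (realWeight_pos hμ)
      (contDiffAt_comp_graphMap h0 hh (by omega) cV) (contDiffAt_comp_graphMap h0 hh (by omega) cW)
      hV.order hW.order α (Nat.sub_le_sub_right hα _)).congr ?_
    filter_upwards [e2, dV, dW, hV.tangent, hW.tangent] with q h1 h2 h3 h4 h5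
    rw [proj_lieBracket (h1.differentiableAt (by simp)) h2 h3 h4 h5]

end HasBracketWeight

/-! ### Sections of the complex tangent bundle -/

theorem fderiv_eq_sum_coord {q : Base ℓ n} (hh : DifferentiableAt ℝ h q) (a : ZIdx ℓ)
    (v : Base ℓ n) : fderiv ℝ h q v a =
      ∑ β, (baseBasis ℓ n).coord β v * fderiv ℝ (fun x => h x a) q (baseBasis ℓ n β) := by
  have h1 : fderiv ℝ (fun x => h x a) q =
      (ContinuousLinearMap.proj a).comp (fderiv ℝ h q) := fderiv_apply hh a
  have h2 : v = ∑ β, (baseBasis ℓ n).coord β v • baseBasis ℓ n β :=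
    ((baseBasis ℓ n).sum_repr v).symm
  conv_lhs => rw [h2, map_sum, Finset.sum_apply]
  refine Finset.sum_congr rfl fun β _ => ?_
  rw [h1, map_smul]
  rfl

/-- If `U` and `J U` are tangent to the graph, then the `x_a`-coefficient of `U` has weighted order
`μ - 1`, where `μ` is the weight of `x_a`. -/
theorem HasBracketWeight.of_tangent_complex (h0 : h 0 = 0) (hd0 : fderiv ℝ h 0 = 0)
    (hh : ContDiffAt ℝ S h 0) (hμ : ∀ i, 0 < μ i) (hμS : ∀ i, μ i ≤ S) (hS : 0 < S)
    (hord : ∀ a : ZIdx ℓ, HasWeightedOrder (baseBasis ℓ n) (realWeight ℓ n μ) (μ a.1)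
      fun q => h q a)
    {U : Amb ℓ n → Amb ℓ n} (hU : ContDiffAt ℝ (S - 1 : ℕ) U 0)
    (tU : ∀ᶠ q in 𝓝 (0 : Base ℓ n), U (graphMap h q) ∈ CRBracket.tangent h (graphMap h q))
    (tJU : ∀ᶠ q in 𝓝 (0 : Base ℓ n),
      Complex.I • U (graphMap h q) ∈ CRBracket.tangent h (graphMap h q)) :
    HasBracketWeight h μ S 1 U := by
  have hw := realWeight_pos (ℓ := ℓ) (n := n) hμ
  have dh : ∀ᶠ q in 𝓝 0, DifferentiableAt ℝ h q := eventually_differentiableAt hS.ne' hh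
  refine ⟨hU, ?_, ?_⟩
  · filter_upwards [dh, tU] with q h1 h2
    exact eq_fderiv_graphMap h1 h2
  set A : RealIdx ℓ n → Base ℓ n → ℝ := fun α q =>
    (baseBasis ℓ n).coord α (toBaseL ℓ n (U (graphMap h q))) with hA
  set B : RealIdx ℓ n → Base ℓ n → ℝ := fun α q =>
    (baseBasis ℓ n).coord α (toBaseL ℓ n (Complex.I • U (graphMap h q))) with hB
  have hJU : ContDiffAt ℝ (S - 1 : ℕ) (fun p => Complex.I • U p) 0 := hU.const_smul Complex.I
  have cA : ∀ α, ContDiffAt ℝ (S - 1 : ℕ) (A α) 0 := fun α =>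
    contDiffAt_basis_coord _ (contDiffAt_comp_graphMap h0 hh (Nat.sub_le _ _) hU) α
  have cB : ∀ α, ContDiffAt ℝ (S - 1 : ℕ) (B α) 0 := fun α =>
    contDiffAt_basis_coord _ (contDiffAt_comp_graphMap h0 hh (Nat.sub_le _ _) hJU) α
  set D : ZIdx ℓ → RealIdx ℓ n → Base ℓ n → ℝ := fun a β q =>
    fderiv ℝ (fun x => h x a) q (baseBasis ℓ n β) with hD
  have cD : ∀ a β, ContDiffAt ℝ (S - 1 : ℕ) (D a β) 0 := fun a β =>
    contDiffAt_dirDeriv (((contDiffAt_pi.1 hh) a).of_le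
      (by exact_mod_cast (by omega : S - 1 + 1 ≤ S))) _
  -- Order 1 comes from dh(0) = 0 and drives the bootstrap; order μ_a - w_β comes from the weight of
  -- h_a.
  have oD : ∀ a β, HasWeightedOrder (baseBasis ℓ n) (realWeight ℓ n μ)
      (max 1 (μ a.1 - realWeight ℓ n μ β)) (D a β) := by
    intro a β
    rcases max_choice 1 (μ a.1 - realWeight ℓ n μ β) with h1 | h1 <;> rw [h1]
    · refine HasWeightedOrder.of_apply_zero hw ?_
      have := fderiv_apply dh.self_of_nhds a
      simp only [hD]
      rw [this, hd0]
      rfl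
    · exact (hord a).dirDeriv β
  -- Tangency of JU, since Im (i U_a) = Re U_a; `eB` is tangency of U, since Re (i U_a) = -Im U_a.
  have eA : ∀ a, (fun q => ∑ β, B β q * D a β q) =ᶠ[𝓝 0] A (Sum.inl a) := by
    intro a
    filter_upwards [dh, tJU] with q h1 h2
    have hq : toBase (graphMap h q) = q := toBase_ofReIm _ _
    rw [mem_tangent_iff (by rwa [hq]), hq] at h2
    simp only [hA, hB, hD]
    rw [← fderiv_eq_sum_coord h1, toBaseL_apply, ← h2 a, baseBasis_coord_inl]
    simp [toBase]
  have eB : ∀ a, (fun q => -∑ β, A β q * D a β q) =ᶠ[𝓝 0] B (Sum.inl a) := by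
    intro a
    filter_upwards [dh, tU] with q h1 h2
    have hq : toBase (graphMap h q) = q := toBase_ofReIm _ _
    rw [mem_tangent_iff (by rwa [hq]), hq] at h2
    simp only [hA, hB, hD]
    rw [← fderiv_eq_sum_coord h1, toBaseL_apply, ← h2 a, baseBasis_coord_inl]
    simp [toBase]
  -- Bootstrap on `e`. In each product, if the coefficient has order e, the factor of order 1 gives
  -- e + 1; if it has order w_β - 1, the factor of order μ_a - w_β gives μ_a - 1.
  have key : ∀ e : ℕ, ∀ α,
      HasWeightedOrder (baseBasis ℓ n) (realWeight ℓ n μ) (min e (realWeight ℓ n μ α - 1)) (A α) ∧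
      HasWeightedOrder (baseBasis ℓ n) (realWeight ℓ n μ) (min e (realWeight ℓ n μ α - 1)) (B α) := by
    intro e
    induction e with
    | zero => intro α; simp only [Nat.zero_min]; exact ⟨.zero, .zero⟩
    | succ e ih =>
      intro α
      cases α with
      | inr c => exact ⟨.zero, .zero⟩
      | inl a =>
        have hS' : min (e + 1) (μ a.1 - 1) ≤ S - 1 := by have := hμS a.1; omega
        have hsum : ∀ F : RealIdx ℓ n → Base ℓ n → ℝ, (∀ β, ContDiffAt ℝ (S - 1 : ℕ) (F β) 0) →
            (∀ β, HasWeightedOrder (baseBasis ℓ n) (realWeight ℓ n μ)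
              (min e (realWeight ℓ n μ β - 1)) (F β)) →
            HasWeightedOrder (baseBasis ℓ n) (realWeight ℓ n μ) (min (e + 1) (μ a.1 - 1))
              (fun q => ∑ β, F β q * D a β q) := fun F cF oF =>
          HasWeightedOrder.sum hw hS' _ (fun β => (oF β).mul hw hS' (by have := hw β; omega)
            (oD a β) (cF β) (cD a β)) (fun β => (cF β).mul (cD a β))
        exact ⟨(hsum B cB fun β => (ih β).2).congr (eA a),
          (hsum A cA fun β => (ih β).1).neg.congr (eB a)⟩
  intro α
  exact ((key (realWeight ℓ n μ α) α).1).mono (by omega)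

end Graph

/-! ### Weights of iterated brackets and their values at the origin -/

section Brackets

variable {r : ℕ} {ℓ : Fin r → ℕ} {n : ℕ} {h : Base ℓ n → ZIdx ℓ → ℝ} {Ω : Set (Base ℓ n)}
  {μ : Fin r → ℕ} {S : ℕ} {s : ℕ∞}

/-- The real and imaginary parts of a section of `T^{1,0} M` or `T^{0,1} M`: here `c = -1` or
`c = 1`. -/
theorem IsTangentField.hasBracketWeight (hΩ : IsOpen Ω) (h0Ω : (0 : Base ℓ n) ∈ Ω) (h0 : h 0 = 0)
    (hd0 : fderiv ℝ h 0 = 0) (hh : ContDiffAt ℝ S h 0) (hμ : ∀ i, 0 < μ i) (hμS : ∀ i, μ i ≤ S)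
    (hS : 0 < S) (hSs : (S : ℕ∞) ≤ s)
    (hord : ∀ a : ZIdx ℓ, HasWeightedOrder (baseBasis ℓ n) (realWeight ℓ n μ) (μ a.1)
      fun q => h q a)
    {type : Amb ℓ n → Amb ℓ n → Prop} {c : ℝ} (hc : c * c = 1)
    (htype : ∀ u v, type u v → v = c • (Complex.I • u))
    {X : CField ℓ n} (hX : IsTangentField Ω h (s - 1) 0 type X) :
    HasBracketWeight h μ S 1 X.re ∧ HasBracketWeight h μ S 1 X.im := by
  obtain ⟨O, hO, h0O, cre, cim, hT⟩ := hX
  have hle : ((S - 1 : ℕ) : WithTop ℕ∞) ≤ ((s - 1 : ℕ∞) : WithTop ℕ∞) := by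
    have : ((S - 1 : ℕ) : ℕ∞) ≤ s - 1 := by
      rw [ENat.natCast_sub]
      exact tsub_le_tsub_right hSs 1
    exact WithTop.coe_le_coe.2 this
  have cre' := (cre.contDiffAt (hO.mem_nhds h0O)).of_le hle
  have cim' := (cim.contDiffAt (hO.mem_nhds h0O)).of_le hle
  have hlim : Filter.Tendsto (graphMap h) (𝓝 0) (𝓝 0) := by
    have := (contDiffAt_graphMap hh).continuousAt.tendsto
    rwa [graphMap_zero h0] at this
  have hev : ∀ᶠ q in 𝓝 (0 : Base ℓ n), graphMap h q ∈ graphSet Ω h ∩ O := by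
    filter_upwards [hΩ.mem_nhds h0Ω, hlim.eventually (hO.mem_nhds h0O)] with q h1 h2
    exact ⟨graphMap_mem_graphSet h1, h2⟩
  -- From v = c J u with c² = 1 follow J u = c v and J v = -c u, so J preserves tangency of both
  -- parts.
  have e1 : ∀ u v : Amb ℓ n, v = c • (Complex.I • u) → Complex.I • u = c • v := by
    rintro u v rfl
    rw [smul_smul, hc, one_smul]
  have e2 : ∀ u v : Amb ℓ n, v = c • (Complex.I • u) → Complex.I • v = -c • u := by
    rintro u v rfl
    rw [smul_comm, smul_smul, Complex.I_mul_I, neg_smul, one_smul, smul_neg, neg_smul]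
  constructor
  · refine HasBracketWeight.of_tangent_complex h0 hd0 hh hμ hμS hS hord cre'
      (hev.mono fun q hq => (hT _ hq).1) (hev.mono fun q hq => ?_)
    rw [e1 _ _ (htype _ _ (hT _ hq).2.2)]
    exact Submodule.smul_mem _ _ (hT _ hq).2.1
  · refine HasBracketWeight.of_tangent_complex h0 hd0 hh hμ hμS hS hord cim'
      (hev.mono fun q hq => (hT _ hq).2.1) (hev.mono fun q hq => ?_)
    rw [e2 _ _ (htype _ _ (hT _ hq).2.2)]
    exact Submodule.smul_mem _ _ (hT _ hq).1

/-- Weights add under brackets. Positivity of `k` is carried along because the bracket step needs it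
for both factors. -/
theorem IsIterBracket.hasBracketWeight (hΩ : IsOpen Ω) (h0Ω : (0 : Base ℓ n) ∈ Ω) (h0 : h 0 = 0)
    (hd0 : fderiv ℝ h 0 = 0) (hh : ContDiffAt ℝ S h 0) (hμ : ∀ i, 0 < μ i) (hμS : ∀ i, μ i ≤ S)
    (hSs : (S : ℕ∞) ≤ s)
    (hord : ∀ a : ZIdx ℓ, HasWeightedOrder (baseBasis ℓ n) (realWeight ℓ n μ) (μ a.1)
      fun q => h q a)
    {k : ℕ} {X : CField ℓ n} (hX : IsIterBracket Ω h (s - 1) 0 k X) (hkS : k < S) :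
    0 < k ∧ HasBracketWeight h μ S k X.re ∧ HasBracketWeight h μ S k X.im := by
  induction hX with
  | hol X hX =>
    exact ⟨one_pos, IsTangentField.hasBracketWeight hΩ h0Ω h0 hd0 hh hμ hμS (by omega) hSs hord
      (c := -1) (by norm_num) (fun u v huv => by rw [huv, neg_smul, one_smul]) hX⟩
  | antihol X hX =>
    exact ⟨one_pos, IsTangentField.hasBracketWeight hΩ h0Ω h0 hd0 hh hμ hμS (by omega) hSs hord
      (c := 1) (by norm_num) (fun u v huv => by rw [huv, one_smul]) hX⟩
  | bracket j k X Y _ _ ihX ihY =>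
    obtain ⟨hj, X1, X2⟩ := ihX (by omega)
    obtain ⟨hk, Y1, Y2⟩ := ihY (by omega)
    have br := fun {V W : Amb ℓ n → Amb ℓ n} (hV : HasBracketWeight h μ S j V)
      (hW : HasBracketWeight h μ S k W) => hV.lieBracket h0 hh hμ hμS hj hk hkS hW
    have hS : 0 < S := by omega
    refine ⟨by omega, ?_, (br X1 Y2).add h0 hh hμ hμS hS (br X2 Y1)⟩
    have := (br X1 Y1).add h0 hh hμ hμS hS (br X2 Y2).neg
    simp only [← sub_eq_add_neg] at this
    exact this

/-- At `0`, the coefficients in the directions of large weight vanish. -/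
theorem HasBracketWeight.apply_zero (h0 : h 0 = 0) (hd0 : fderiv ℝ h 0 = 0)
    (hh : ContDiffAt ℝ S h 0) (hS : 0 < S) {k : ℕ} {W : Amb ℓ n → Amb ℓ n}
    (hW : HasBracketWeight h μ S k W) (a : ZIdx ℓ) :
    ((W 0).1 a).im = 0 ∧ (k < μ a.1 → ((W 0).1 a).re = 0) := by
  constructor
  · have h1 := hW.tangent.self_of_nhds
    rw [graphMap_zero h0, fderiv_graphMap (hh.differentiableAt (by exact_mod_cast hS.ne')), hd0]
      at h1
    rw [h1]
    simp [ofReIm_apply]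
  · intro hk
    have h1 := (hW.order (Sum.inl a)).apply_zero (Nat.sub_pos_of_lt hk)
    rwa [graphMap_zero h0, baseBasis_coord_inl] at h1

end Brackets

/-! ### Coordinate vectors -/

section CoordSpan

variable {r : ℕ} {ℓ : Fin r → ℕ} {n : ℕ}

theorem one_tmul_mem_coordSpan {i : Fin r} {u : Amb ℓ n} (him : ∀ a, (u.1 a).im = 0)
    (hre : ∀ a : ZIdx ℓ, i ≤ a.1 → (u.1 a).re = 0) :
    (1 : ℂ) ⊗ₜ[ℝ] u ∈ coordSpan ℓ n i := by
  have hdec : u = ∑ a, (u.1 a).re • ((Pi.single a 1, 0) : Amb ℓ n) +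
      ∑ c, ((u.2 c).re • ((0, Pi.single c 1) : Amb ℓ n) +
        (u.2 c).im • ((0, Pi.single c Complex.I) : Amb ℓ n)) := by
    refine Prod.ext (funext fun a => ?_) (funext fun c => ?_)
    · have : u.1 a = (u.1 a).re := Complex.ext rfl (by simp [him a])
      simp only [Prod.fst_add, Prod.fst_sum, Pi.add_apply, Finset.sum_apply,
        Pi.smul_apply, Pi.single_apply, Prod.smul_mk, Pi.zero_apply]
      simpa using this
    · simp only [Prod.snd_add, Prod.snd_sum, Pi.add_apply, Finset.sum_apply,
        Pi.smul_apply, Pi.single_apply, Prod.smul_mk, Pi.zero_apply, Finset.sum_add_distrib]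
      simp
  have e1 : ∀ c, (1 : ℂ) ⊗ₜ[ℝ] ((0, Pi.single c 1) : Amb ℓ n) = dW ℓ n c + dWbar ℓ n c := by
    intro c
    rw [dW, dWbar, sub_add_add_cancel, ← TensorProduct.add_tmul]
    norm_num
  have e2 : ∀ c, (1 : ℂ) ⊗ₜ[ℝ] ((0, Pi.single c Complex.I) : Amb ℓ n) =
      Complex.I • (dW ℓ n c - dWbar ℓ n c) := by
    intro c
    have : dW ℓ n c - dWbar ℓ n c = -((Complex.I / 2) ⊗ₜ[ℝ] ((0, Pi.single c Complex.I) : Amb ℓ n) +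
        (Complex.I / 2) ⊗ₜ[ℝ] ((0, Pi.single c Complex.I) : Amb ℓ n)) := by
      rw [dW, dWbar]
      abel
    rw [this, ← TensorProduct.add_tmul, add_halves, smul_neg, TensorProduct.smul_tmul',
      ← TensorProduct.neg_tmul, smul_eq_mul, Complex.I_mul_I, neg_neg]
  have mW : ∀ c, dW ℓ n c ∈ coordSpan ℓ n i := fun c =>
    Submodule.subset_span (Or.inl (Or.inl ⟨c, rfl⟩))
  have mWbar : ∀ c, dWbar ℓ n c ∈ coordSpan ℓ n i := fun c =>
    Submodule.subset_span (Or.inl (Or.inr ⟨c, rfl⟩))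
  have mR : ∀ (t : ℝ) {v : Amb ℓ n}, (1 : ℂ) ⊗ₜ[ℝ] v ∈ coordSpan ℓ n i →
      (1 : ℂ) ⊗ₜ[ℝ] (t • v) ∈ coordSpan ℓ n i := by
    intro t v hv
    rw [TensorProduct.tmul_smul]
    exact ((coordSpan ℓ n i).restrictScalars ℝ).smul_mem t hv
  rw [hdec, TensorProduct.tmul_add, TensorProduct.tmul_sum, TensorProduct.tmul_sum]
  refine Submodule.add_mem _ (Submodule.sum_mem _ fun a _ => ?_)
    (Submodule.sum_mem _ fun c _ => ?_)
  · rcases lt_or_ge a.1 i with ha | ha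
    · exact mR _ (Submodule.subset_span (Or.inr ⟨a, ha, rfl⟩))
    · simp [hre a ha]
  · rw [TensorProduct.tmul_add]
    refine Submodule.add_mem _ (mR _ ?_) (mR _ ?_)
    · rw [e1]
      exact Submodule.add_mem _ (mW c) (mWbar c)
    · rw [e2]
      exact Submodule.smul_mem _ _ (Submodule.sub_mem _ (mW c) (mWbar c))

/-- The complex linear extension of `v ↦ Re z_a (v)`. -/
def reCoord (a : ZIdx ℓ) : ℂ ⊗[ℝ] Amb ℓ n →ₗ[ℂ] ℂ :=
  TensorProduct.AlgebraTensorModule.lift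
    ((LinearMap.toSpanSingleton ℂ (Amb ℓ n →ₗ[ℝ] ℂ)
      (Complex.ofRealCLM.toLinearMap ∘ₗ Complex.reLm ∘ₗ LinearMap.proj a ∘ₗ
        LinearMap.fst ℝ (ZIdx ℓ → ℂ) (Fin n → ℂ))))

theorem reCoord_tmul (a : ZIdx ℓ) (c : ℂ) (v : Amb ℓ n) :
    reCoord a (c ⊗ₜ[ℝ] v) = c * ((v.1 a).re : ℂ) := rfl

/-- This is what makes the map on the quotient well defined. -/
theorem reCoord_eq_zero {i : Fin r} {a : ZIdx ℓ} (ha : i ≤ a.1) {v : ℂ ⊗[ℝ] Amb ℓ n}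
    (hv : v ∈ coordSpan ℓ n i) : reCoord a v = 0 := by
  suffices coordSpan ℓ n i ≤ LinearMap.ker (reCoord a) from this hv
  refine Submodule.span_le.2 ?_
  rintro _ ((⟨c, rfl⟩ | ⟨c, rfl⟩) | ⟨a', ha', rfl⟩)
  · simp [dW, reCoord_tmul]
  · simp [dWbar, reCoord_tmul]
  · have : a ≠ a' := by rintro rfl; exact absurd ha (not_le.2 ha')
    simp [dX, reCoord_tmul, this]

end CoordSpan

/-! ### Reduction to finite weights, and the map on the quotient -/

section Main

variable {r : ℕ} {ℓ : Fin r → ℕ} {n : ℕ} {h : Base ℓ n → ZIdx ℓ → ℝ} {Ω : Set (Base ℓ n)}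

/-- Finite substitutes for the weights and for the order of regularity. -/
theorem exists_finite_weights {m : Fin r → ℕ∞} {s : ℕ∞} (hpos : ∀ i, 0 < m i) (hm : Monotone m)
    (hs : ∀ i, m i ≤ s) {i : Fin r} {k : ℕ} (hk : (k : ℕ∞) ≤ m i - 1) :
    ∃ N S : ℕ, 0 < N ∧ (S : ℕ∞) ≤ s ∧ k < S ∧ (∀ j, WithTop.untopD N (m j) ≤ N) ∧
      (∀ j, 0 < WithTop.untopD N (m j)) ∧ (∀ j, WithTop.untopD N (m j) ≤ S) ∧
      ∀ j, i ≤ j → k < WithTop.untopD N (m j) := by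
  -- N exceeds k and bounds all finite weights, so it can replace an infinite weight, and also an
  -- infinite regularity.
  set N := k + 1 + ∑ j, WithTop.untopD 0 (m j) with hN
  have hle : ∀ j (t : ℕ), m j = t → t ≤ N := by
    intro j t ht
    have := Finset.single_le_sum (f := fun j => WithTop.untopD 0 (m j))
      (fun _ _ => Nat.zero_le _) (Finset.mem_univ j)
    simp only [ht] at this
    have h2 : t ≤ ∑ j, WithTop.untopD 0 (m j) := this
    omega
  have htop : WithTop.untopD N (⊤ : ℕ∞) = N := rfl
  have hcoe : ∀ t : ℕ, WithTop.untopD N (t : ℕ∞) = t := fun _ => rfl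
  have hkm : ((k + 1 : ℕ) : ℕ∞) ≤ m i := by
    push_cast
    exact (add_le_add_left hk 1).trans (tsub_add_cancel_of_le (Order.one_le_iff_pos.2 (hpos i))).le
  have hkm' : ∀ (c : ℕ∞), ((k + 1 : ℕ) : ℕ∞) ≤ c → k < WithTop.untopD N c := by
    intro c hc
    induction c using ENat.recTopCoe with
    | top => rw [htop]; omega
    | coe t => rw [hcoe]; exact_mod_cast hc
  refine ⟨N, WithTop.untopD N s, by omega, ?_, hkm' _ (hkm.trans (hs i)), fun j => ?_, fun j => ?_,
    fun j => ?_, fun j hj => hkm' _ (hkm.trans (hm hj))⟩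
  · induction s using ENat.recTopCoe with
    | top => exact le_top
    | coe t => exact le_rfl
  · have := hle j
    generalize m j = c at this
    induction c using ENat.recTopCoe with
    | top => exact le_rfl
    | coe t => exact this t rfl
  · have := hpos j
    generalize m j = c at this
    induction c using ENat.recTopCoe with
    | top => rw [htop]; omega
    | coe t => rw [hcoe]; exact_mod_cast this
  · have h1 := hs j
    have h2 := hle j
    generalize m j = c at h1 h2
    induction s using ENat.recTopCoe with
    | top =>
      rw [htop]
      induction c using ENat.recTopCoe with
      | top => exact le_rfl
      | coe t => exact h2 t rfl
    | coe u =>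
      induction c using ENat.recTopCoe with
      | top => simp at h1
      | coe t => rw [hcoe, hcoe]; exact_mod_cast h1

/-- It suffices to treat one bracket at a time. Its length is finite, so the finite substitutes may
depend on it even when m_i is infinite. -/
theorem bracketSpace_le_coordSpan {m : Fin r → ℕ∞} {s : ℕ∞} (hpos : ∀ i, 0 < m i)
    (hm : Monotone m) (hs : ∀ i, m i ≤ s) (hΩ : IsOpen Ω) (h0Ω : (0 : Base ℓ n) ∈ Ω)
    (hsmooth : ContDiffOn ℝ (s : WithTop ℕ∞) h Ω) (h0 : h 0 = 0) (hd0 : fderiv ℝ h 0 = 0)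
    (hweight : ∀ a : ZIdx ℓ, VanishesToWeight m (fun p => h p a) (m a.1)) (i : Fin r) :
    bracketSpace Ω h (s - 1) 0 (m i - 1) ≤ coordSpan ℓ n i := by
  refine Submodule.span_le.2 ?_
  rintro _ ⟨k, X, hk, hX, rfl⟩
  obtain ⟨N, S, hN, hSs, hkS, hmN, hμ, hμS, hμk⟩ := exists_finite_weights hpos hm hs hk
  have hh : ContDiffAt ℝ S h 0 :=
    (hsmooth.contDiffAt (hΩ.mem_nhds h0Ω)).of_le (by exact_mod_cast hSs)
  have hord : ∀ a : ZIdx ℓ, HasWeightedOrder (baseBasis ℓ n)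
      (realWeight ℓ n fun j => WithTop.untopD N (m j)) (WithTop.untopD N (m a.1))
      fun q => h q a := fun a =>
    HasWeightedOrder.of_isBigO (realWeight_pos hμ) (hμS a.1) ((contDiffAt_pi.1 hh) a) _
      (dilation_zero _) (dilation_add_basis _) (hweight a N hN (hmN a.1))
  obtain ⟨-, h1, h2⟩ := hX.hasBracketWeight hΩ h0Ω h0 hd0 hh hμ hμS hSs hord hkS
  have z1 := h1.apply_zero h0 hd0 hh (by omega)
  have z2 := h2.apply_zero h0 hd0 hh (by omega)
  have hI : Complex.I ⊗ₜ[ℝ] X.im 0 = Complex.I • ((1 : ℂ) ⊗ₜ[ℝ] X.im 0) := by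
    rw [TensorProduct.smul_tmul', smul_eq_mul, mul_one]
  rw [CField.val, hI]
  exact Submodule.add_mem _
    (one_tmul_mem_coordSpan (fun a => (z1 a).1) fun a ha => (z1 a).2 (hμk _ ha))
    (Submodule.smul_mem _ _
      (one_tmul_mem_coordSpan (fun a => (z2 a).1) fun a ha => (z2 a).2 (hμk _ ha)))

/-- At 0 the differential of the defining function is -dy_a, and tangent vectors have Im v_a = 0,
which kills the imaginary part. -/
theorem del_defFun_I_smul (hdiff : DifferentiableAt ℝ h 0) (hd0 : fderiv ℝ h 0 = 0) (a : ZIdx ℓ)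
    {v : Amb ℓ n} (hv : v ∈ tangent h 0) :
    del (defFun h a) 0 (Complex.I • v) = ((-(1 / 2) * (v.1 a).re : ℝ) : ℂ) := by
  have hdiff' : DifferentiableAt ℝ h (toBase (0 : Amb ℓ n)) := hdiff
  have hz : fderiv ℝ h (toBase (0 : Amb ℓ n)) = 0 := hd0
  have him := (mem_tangent_iff hdiff').1 hv a
  rw [del, fderiv_defFun hdiff', fderiv_defFun hdiff', hz]
  rw [hz] at him
  simp only [zero_apply, Pi.zero_apply] at him
  simp [smul_smul, him]

end Main

end CRBracket

end

theorem proposition3p1 {r n : ℕ} (ℓ : Fin r → ℕ) (m : Fin r → ℕ∞) (s : ℕ∞)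
    (hpos : ∀ i, 0 < m i) (hmono : StrictMono m) (hs : ∀ i, m i ≤ s)
    (Ω : Set (CRBracket.Base ℓ n)) (hΩ : IsOpen Ω) (h0Ω : (0 : CRBracket.Base ℓ n) ∈ Ω)
    (h : CRBracket.Base ℓ n → CRBracket.ZIdx ℓ → ℝ)
    (hsmooth : ContDiffOn ℝ (s : WithTop ℕ∞) h Ω)
    (h0 : h 0 = 0) (hd0 : fderiv ℝ h 0 = 0)
    (hweight : ∀ a : CRBracket.ZIdx ℓ,
      CRBracket.VanishesToWeight m (fun p => h p a) (m a.1)) :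
    ∀ i : Fin r,
      CRBracket.bracketSpace Ω h (s - 1) 0 (m i - 1) ≤ CRBracket.coordSpan ℓ n i ∧
      (∀ i' : Fin r, i'.val + 1 = i.val →
        CRBracket.bracketSpace Ω h (s - 1) 0 (m i') ≤ CRBracket.coordSpan ℓ n i) ∧
      ∃! φ : (CRBracket.tangent h 0 ⧸ CRBracket.realBracketSpace Ω h (s - 1) 0 (m i - 1))
          →ₗ[ℝ] ({a : CRBracket.ZIdx ℓ // i ≤ a.1} → ℝ),
        ∀ (v : CRBracket.tangent h 0) (a : {a : CRBracket.ZIdx ℓ // i ≤ a.1}),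
          ((φ (Submodule.Quotient.mk v) a : ℝ) : ℂ) =
            CRBracket.del (CRBracket.defFun h a.1) 0 (Complex.I • (v : CRBracket.Amb ℓ n)) := by
  intro i
  have hmain := CRBracket.bracketSpace_le_coordSpan hpos hmono.monotone hs hΩ h0Ω hsmooth h0 hd0
    hweight i
  have hs0 : s ≠ 0 := ((hpos i).trans_le (hs i)).ne'
  have hdiff : DifferentiableAt ℝ h 0 :=
    (hsmooth.contDiffAt (hΩ.mem_nhds h0Ω)).differentiableAt (by exact_mod_cast hs0)
  refine ⟨hmain, fun i' hi' => ?_, ?_⟩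
  · have hlt : m i' < m i := hmono (Fin.lt_def.2 (by omega))
    refine (Submodule.span_mono ?_).trans hmain
    rintro _ ⟨k, X, hk, hX, rfl⟩
    exact ⟨k, X, hk.trans (ENat.le_sub_one_of_lt hlt), hX, rfl⟩
  · let ψ : CRBracket.tangent h 0 →ₗ[ℝ] ({a : CRBracket.ZIdx ℓ // i ≤ a.1} → ℝ) :=
      { toFun := fun v a => -(1 / 2) * (v.1.1 a.1).re
        map_add' := fun v v' => by ext a; simp; ring
        map_smul' := fun t v => by ext a; simp; ring }
    have hker : CRBracket.realBracketSpace Ω h (s - 1) 0 (m i - 1) ≤ LinearMap.ker ψ := by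
      intro v hv
      ext a
      have h1 := CRBracket.reCoord_eq_zero a.2 (hmain hv)
      rw [TensorProduct.mk_apply, CRBracket.reCoord_tmul, one_mul] at h1
      have h2 : (v.1.1 a.1).re = 0 := by exact_mod_cast h1
      simp [ψ, h2]
    refine ⟨Submodule.liftQ _ ψ hker, fun v a => ?_, fun φ hφ => ?_⟩
    · rw [CRBracket.del_defFun_I_smul hdiff hd0 a.1 v.2]
      rfl
    · refine LinearMap.ext fun x => ?_
      obtain ⟨v, rfl⟩ := Submodule.Quotient.mk_surjective _ x
      ext a
      have h1 := hφ v a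
      rw [CRBracket.del_defFun_I_smul hdiff hd0 a.1 v.2] at h1
      exact_mod_cast h1
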